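/- Let $\mathbb F=\mathbb R\{\!\{\varpi\}\!\}$ be the field of Puiseux series over $\mathbb R$ in $\varpi$ (series $\sum_{k\ge \ell}c_k\varpi^{k/N}$ with $\ell,N\in\mathbb Z$, $N>0$, $c_k\in\mathbb R$), and let $\overline{\mathbb F}$ be its algebraic closure. Let $n\ge 1$, let $p\in\mathbb R[x_1,\dots,x_n]$ and let $a\in\overline{\mathbb F}^{\,n}$. Put $$S=\Big\{x\in\overline{\mathbb F}^{\,n} : \varpi\big((x_1-a_1)^2+\dots+(x_n-a_n)^2\big)-1=0\Big\},$$ $$\Gamma_{\overline{\mathbb F}}(p,a)=\Big\{x\in S : (x_i-a_i)\tfrac{\partial p}{\partial x_n}(x)-(x_n-a_n)\tfrac{\partial p}{\partial x_i}(x)=0\ \text{ for } i=1,\dots,n-1\Big\},$$ $$\Delta_{\overline{\mathbb F}}(p,a)=\Big\{x\in\Gamma_{\overline{\mathbb F}}(p,a) : \tfrac{\partial p}{\partial x_n}(x)\ne 0\Big\},$$ and let $$C(p,a)=\big\{x\in S : \text{there is } c\in\overline{\mathbb F}\text{ with }\nabla p(x)=c\,(x-a)\big\}$$ be the critical set of $p$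 on the sphere $S$. **Proposition.** The image $p(\Delta_{\overline{\mathbb F}}(p,a))\subset\overline{\mathbb F}$ is finite. More generally, $p$ takes finitely many values on its critical set on the sphere, that is, $p(C(p,a))$ is finite; and $p$ takes finitely many values on the set of all points of $\Gamma_{\overline{\mathbb F}}(p,a)$ except those at which both $x_n=a_n$ and $\frac{\partial p}{\partial x_n}(x)=0$. -/

import Mathlib

/-- The field `K{{ϖ}}` of Puiseux series over `K`, as a subfield of the field of Hahn series with
rational exponents: the series whose exponents have a common denominator, i.e. the support is
contained in `(1/N)ℤ` for some `N > 0`. (The support of a Hahn series is well-ordered, so together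
with this condition it is bounded below, and such a series is `∑_{k ≥ ℓ} c_k ϖ^{k/N}`.) -/
noncomputable def PuiseuxSeries (K : Type*) [Field K] : IntermediateField K (HahnSeries ℚ K) where
  carrier := {f | ∃ N : ℕ, 0 < N ∧ ∀ q ∈ f.support, ∃ k : ℤ, q = (k : ℚ) / (N : ℚ)}
  mul_mem' := by
    rintro f g ⟨N, hN, hf⟩ ⟨M, hM, hg⟩
    refine ⟨N * M, Nat.mul_pos hN hM, fun q hq => ?_⟩
    obtain ⟨u, hu, v, hv, rfl⟩ := Set.mem_add.1 (HahnSeries.support_mul_subset hq)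
    obtain ⟨k, rfl⟩ := hf u hu
    obtain ⟨l, rfl⟩ := hg v hv
    refine ⟨k * M + l * N, ?_⟩
    have hN' : (N : ℚ) ≠ 0 := by positivity
    have hM' : (M : ℚ) ≠ 0 := by positivity
    push_cast
    field_simp
  add_mem' := by
    rintro f g ⟨N, hN, hf⟩ ⟨M, hM, hg⟩
    have hN' : (N : ℚ) ≠ 0 := by positivity
    have hM' : (M : ℚ) ≠ 0 := by positivity
    refine ⟨N * M, Nat.mul_pos hN hM, fun q hq => ?_⟩
    rcases HahnSeries.support_add_subset f g hq with h | h
    · obtain ⟨k, rfl⟩ := hf q h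
      refine ⟨k * M, ?_⟩
      push_cast
      field_simp
    · obtain ⟨k, rfl⟩ := hg q h
      refine ⟨k * N, ?_⟩
      push_cast
      field_simp
  algebraMap_mem' := by
    intro r
    refine ⟨1, Nat.one_pos, fun q hq => ⟨0, ?_⟩⟩
    have hC : algebraMap K (HahnSeries ℚ K) r = HahnSeries.single 0 r := by
      rw [HahnSeries.algebraMap_apply', PowerSeries.algebraMap_apply, HahnSeries.ofPowerSeries_C]
      rfl
    rw [hC] at hq
    simpa using HahnSeries.support_single_subset hq
  inv_mem' := by
    rintro f ⟨N, hN, hf⟩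
    have hN' : (0 : ℚ) < (N : ℚ) := by positivity
    let φ : ℤ →+ ℚ := (AddMonoidHom.mulRight ((N : ℚ)⁻¹)).comp (Int.castAddHom ℚ)
    have hφ : ∀ k : ℤ, φ k = (k : ℚ) / (N : ℚ) := fun k => (div_eq_mul_inv _ _).symm
    have hle : ∀ k l : ℤ, φ k ≤ φ l ↔ k ≤ l := by
      intro k l
      rw [hφ, hφ, div_le_div_iff_of_pos_right hN', Int.cast_le]
    have hinj : Function.Injective φ := fun k l h =>
      le_antisymm ((hle k l).1 h.le) ((hle l k).1 h.ge)
    let Ψ : HahnSeries ℤ K →+* HahnSeries ℚ K := HahnSeries.embDomainRingHom φ hinj hle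
    let e : ℤ ↪o ℚ := ⟨⟨φ, hinj⟩, fun {k l} => hle k l⟩
    have hΨ : ∀ g, Ψ g = HahnSeries.embDomain e g := fun _ => rfl
    have hwo : {k : ℤ | f.coeff (φ k) ≠ 0}.IsPWO := by
      refine Set.partiallyWellOrderedOn_iff_exists_lt.2 fun u hu => ?_
      obtain ⟨m, n, hmn, h⟩ :=
        Set.partiallyWellOrderedOn_iff_exists_lt.1 f.isPWO_support (fun i => φ (u i)) hu
      exact ⟨m, n, hmn, (hle _ _).1 h⟩
    have hg : Ψ ⟨fun k => f.coeff (φ k), hwo⟩ = f := by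
      rw [hΨ]
      ext q
      by_cases hq : q ∈ Set.range e
      · obtain ⟨k, rfl⟩ := hq
        rw [HahnSeries.embDomain_coeff]
        rfl
      · rw [HahnSeries.embDomain_of_notMem_range hq]
        by_contra h
        obtain ⟨k, hk⟩ := hf q (Ne.symm h)
        exact hq ⟨k, by rw [hk]; exact hφ k⟩
    refine ⟨N, hN, fun q hq => ?_⟩
    rw [← hg, ← map_inv₀, hΨ] at hq
    obtain ⟨k, -, rfl⟩ := HahnSeries.support_embDomain_subset hq
    exact ⟨k, hφ k⟩

/-- The field `𝔽 = ℝ{{ϖ}}`. -/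
abbrev FF : Type := PuiseuxSeries ℝ

/-- The algebraic closure `𝔽̄` of `𝔽 = ℝ{{ϖ}}`. -/
abbrev FFbar : Type := AlgebraicClosure FF

/-- The infinitesimal `ϖ` as an element of `𝔽`. -/
noncomputable def varpi : FF :=
  ⟨HahnSeries.single (1 : ℚ) (1 : ℝ), 1, Nat.one_pos, fun q hq =>
    ⟨1, by simpa using HahnSeries.support_single_subset hq⟩⟩

/-- The value `p(x)` at a point `x` with coordinates in `𝔽̄` of a real polynomial `p`. -/
noncomputable def polyVal {ι : Type*} (p : MvPolynomial ι ℝ) (x : ι → FFbar) : FFbar :=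
  MvPolynomial.aeval x p

/-- The value `(∂p/∂x_i)(x)`. -/
noncomputable def partialVal {ι : Type*} (p : MvPolynomial ι ℝ) (i : ι) (x : ι → FFbar) : FFbar :=
  polyVal (MvPolynomial.pderiv i p) x

/-- `Φ_i(x,a) = (x_i - a_i) ∂p/∂x_n - (x_n - a_n) ∂p/∂x_i`. The number of variables is
`n = m + 1`, and the last variable `x_n` has index `Fin.last m`. -/
noncomputable def Phi {m : ℕ} (p : MvPolynomial (Fin (m + 1)) ℝ) (a : Fin (m + 1) → FFbar)
    (i : Fin m) (x : Fin (m + 1) → FFbar) : FFbar :=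
  (x i.castSucc - a i.castSucc) * partialVal p (Fin.last m) x
    - (x (Fin.last m) - a (Fin.last m)) * partialVal p i.castSucc x

/-- The sphere `ϖ ((x_1 - a_1)² + ⋯ + (x_n - a_n)²) - 1 = 0` in `𝔽̄ⁿ`. -/
def sphereSet {ι : Type*} [Fintype ι] (a : ι → FFbar) : Set (ι → FFbar) :=
  {x | algebraMap FF FFbar varpi * ∑ i, (x i - a i) ^ 2 - 1 = 0}

/-- `Γ(p,a)`: the common zeros in `𝔽̄ⁿ` of `Φ_1, …, Φ_{n-1}` and of the equation of the sphere. -/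
def GammaSet {m : ℕ} (p : MvPolynomial (Fin (m + 1)) ℝ) (a : Fin (m + 1) → FFbar) :
    Set (Fin (m + 1) → FFbar) :=
  {x | (∀ i : Fin m, Phi p a i x = 0) ∧ x ∈ sphereSet a}

/-- `Δ(p,a)`: the points of `Γ(p,a)` at which `∂p/∂x_n` does not vanish. -/
def DeltaSet {m : ℕ} (p : MvPolynomial (Fin (m + 1)) ℝ) (a : Fin (m + 1) → FFbar) :
    Set (Fin (m + 1) → FFbar) :=
  GammaSet p a \ {x | partialVal p (Fin.last m) x = 0}

/-- The critical set of `p` on the sphere: the points `x` of the sphere at which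
`∇p(x) = c (x - a)` for some scalar `c`. -/
def sphereCritSet {ι : Type*} [Fintype ι] (p : MvPolynomial ι ℝ) (a : ι → FFbar) :
    Set (ι → FFbar) :=
  {x | x ∈ sphereSet a ∧ ∃ c : FFbar, ∀ i, partialVal p i x = c * (x i - a i)}

/-! This is an algebraic Sard argument. Adjoin the multiplier `c` as a coordinate, and let `R` be
the ring of the equations `∇p = c (x - a)` and `∑ (x_i - a_i)² = r`. In `Ω[R⁄K]`, `dp = c ∑ (x_i -
a_i) dx_i`, and this sum is zero because twice it is `dr = 0`. In characteristic zero, a function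
with zero differential is algebraic over `K` on each irreducible component, hence constant there as
`K` is algebraically closed. There are finitely many components, so finitely many values. -/

open MvPolynomial in
/-- The chain rule for a derivation applied to a polynomial expression. -/
theorem Derivation.map_aeval_mvPolynomial {k R M ι : Type*} [CommRing k] [CommRing R] [Algebra k R]
    [AddCommGroup M] [Module R M] [Module k M] [IsScalarTower k R M] [Fintype ι]
    (D : Derivation k R M) (y : ι → R) (p : MvPolynomial ι k) :
    D (aeval y p) = ∑ i, aeval y (pderiv i p) • D (y i) := by
  classical
  induction p using MvPolynomial.induction_on with
  | C r => simp
  | add p q hp hq => simp [hp, hq, add_smul, Finset.sum_add_distrib]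
  | mul_X p j hp =>
    simp only [map_mul, aeval_X, Derivation.leibniz, hp, pderiv_X, smul_eq_mul, map_add, add_smul,
      Finset.sum_add_distrib, Finset.smul_sum, mul_smul]
    congr 1
    rw [Finset.sum_eq_single j]
    · simp
    · intro i _ hij
      simp [hij.symm]
    · simp

open Polynomial in
/-- In a finitely generated field extension of characteristic zero, the differential of a
transcendental element does not vanish. -/
theorem KaehlerDifferential.D_ne_zero_of_transcendental {K L : Type*} [Field K] [Field L]
    [Algebra K L] [CharZero K] [Algebra.EssFiniteType K L] {x : L} (hx : Transcendental K x) :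
    KaehlerDifferential.D K L x ≠ 0 := by
  algebraize [(aeval x : K[X] →ₐ[K] L).toRingHom]
  have hinj : Function.Injective (algebraMap K[X] L) :=
    transcendental_iff_injective.mp hx
  have : FaithfulSMul K[X] L := (faithfulSMul_iff_algebraMap_injective _ _).mpr hinj
  have : IsScalarTower K K[X] L := IsScalarTower.of_algebraMap_eq' (aeval x).comp_algebraMap.symm
  let _ : Algebra (FractionRing K[X]) L := FractionRing.liftAlgebra K[X] L
  have : IsScalarTower K (FractionRing K[X]) L := .to₁₃₄ K K[X] (FractionRing K[X]) L
  have : CharZero (FractionRing K[X]) :=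
    charZero_of_injective_algebraMap (algebraMap K (FractionRing K[X])).injective
  have : Algebra.EssFiniteType (FractionRing K[X]) L := .of_comp K _ _
  -- `L` is formally smooth over `K(x)`, by characteristic zero, hence over `K[X]`. So `H1Cotangent`
  -- vanishes and `L ⊗ Ω[K[X]⁄K] → Ω[L⁄K]` is injective; it sends `1 ⊗ dX` to `dx`.
  have : Algebra.FormallySmooth K[X] (FractionRing K[X]) :=
    .of_isLocalization (nonZeroDivisors _)
  have : Algebra.FormallySmooth K[X] L := .comp _ (FractionRing K[X]) _
  have : Subsingleton (Algebra.H1Cotangent K[X] L) := this.subsingleton_h1Cotangent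
  have hex := Algebra.H1Cotangent.exact_δ_mapBaseChange (R := K) (S := K[X]) (T := L)
  have hX : algebraMap K[X] L X = x := aeval_X x
  intro h0
  have hker : KaehlerDifferential.mapBaseChange K K[X] L
      (1 ⊗ₜ KaehlerDifferential.D K K[X] X) = 0 := by
    simp [KaehlerDifferential.mapBaseChange_tmul, hX, h0]
  obtain ⟨z, hz⟩ := (hex _).mp hker
  rw [Subsingleton.elim z 0, map_zero] at hz
  -- Identifying `Ω[K[X]⁄K]` with `K[X]` turns `1 ⊗ dX = 0` into `1 = 0` in `L`.
  have h1 := congrArg (TensorProduct.rid K[X] L ∘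
    ((KaehlerDifferential.polynomialEquiv K).toLinearMap.lTensor L)) hz
  simp at h1

/-- **Algebraic Sard theorem**: an element of a finitely generated algebra over an algebraically
closed field of characteristic zero whose differential vanishes takes finitely many values at
rational points. -/
theorem finite_range_eval_of_kaehlerDifferential_D_eq_zero {K R : Type*} [Field K] [IsAlgClosed K]
    [CharZero K] [CommRing R] [Algebra K R] [Algebra.FiniteType K R] {f : R}
    (hf : KaehlerDifferential.D K R f = 0) :
    (Set.range fun φ : R →ₐ[K] K => φ f).Finite := by
  have : IsNoetherianRing R := Algebra.FiniteType.isNoetherianRing K R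
  have key : ∀ P ∈ minimalPrimes R, ∃ k : K, f - algebraMap K R k ∈ P := by
    intro P hP
    have : P.IsPrime := hP.1.1
    -- `L` is the function field of the component cut out by `P`.
    let L := FractionRing (R ⧸ P)
    have : IsScalarTower K R L := .to₁₂₄ K R (R ⧸ P) L
    have : Algebra.EssFiniteType (R ⧸ P) L := .of_isLocalization _ (nonZeroDivisors (R ⧸ P))
    have : Algebra.EssFiniteType K L := .comp K (R ⧸ P) L
    have hD : KaehlerDifferential.D K L (algebraMap R L f) = 0 := by
      rw [← KaehlerDifferential.map_D K K R L, hf, map_zero]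
    have halg : IsAlgebraic K (algebraMap R L f) := by
      by_contra h
      exact KaehlerDifferential.D_ne_zero_of_transcendental h hD
    have := IntermediateField.isAlgebraic_adjoin_simple halg.isIntegral
    obtain ⟨k, hk⟩ := (IntermediateField.mem_bot (F := K)).mp
      ((IntermediateField.eq_bot_of_isAlgClosed_of_isAlgebraic _).le
        (IntermediateField.mem_adjoin_simple_self K (algebraMap R L f)))
    refine ⟨k, ?_⟩
    rw [← Ideal.Quotient.eq_zero_iff_mem]
    apply IsFractionRing.injective (R ⧸ P) L
    rw [map_zero, ← Ideal.Quotient.algebraMap_eq, ← IsScalarTower.algebraMap_apply, map_sub,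
      ← IsScalarTower.algebraMap_apply, hk, sub_self]
  choose! k hk using key
  refine ((minimalPrimes.finite_of_isNoetherianRing R).image k).subset ?_
  rintro _ ⟨φ, rfl⟩
  have : (RingHom.ker φ).IsPrime := RingHom.ker_isPrime φ.toRingHom
  obtain ⟨P, hP, hle⟩ := Ideal.exists_minimalPrimes_le (bot_le : ⊥ ≤ RingHom.ker φ)
  refine ⟨P, hP, ?_⟩
  have := hle (hk P hP)
  rw [RingHom.mem_ker, map_sub, AlgHom.commutes, sub_eq_zero] at this
  exact this.symm

open MvPolynomial in
/-- A derivation kills a polynomial at a point of a sphere where its gradient is proportional to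
the radius vector. -/
theorem Derivation.map_aeval_eq_zero_of_sphere {K R M ι : Type*} [Field K] [CharZero K]
    [CommRing R] [Algebra K R] [AddCommGroup M] [Module R M] [Module K M] [IsScalarTower K R M]
    [Fintype ι] (D : Derivation K R M) {p : MvPolynomial ι K} {y : ι → R} {a : ι → K} {r : K}
    {c : R} (hy : ∑ i, (y i - algebraMap K R (a i)) ^ 2 = algebraMap K R r)
    (hc : ∀ i, aeval y (pderiv i p) = c * (y i - algebraMap K R (a i))) :
    D (aeval y p) = 0 := by
  have h := congrArg D hy
  simp only [map_sum, Derivation.leibniz_pow, map_sub, Derivation.map_algebraMap, sub_zero,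
    Nat.add_one_sub_one, pow_one, ← Finset.smul_sum] at h
  have h2 : (2 : K) • ∑ i, (y i - algebraMap K R (a i)) • D (y i) = 0 := by
    rw [← h, ofNat_smul_eq_nsmul]
  simp only [Derivation.map_aeval_mvPolynomial, hc, mul_smul]
  rw [← Finset.smul_sum, (smul_eq_zero.mp h2).resolve_left two_ne_zero, smul_zero]

open MvPolynomial in
/-- A polynomial takes finitely many values on its critical set on a sphere. -/
theorem MvPolynomial.finite_image_criticalSet_sphere {K ι : Type*} [Field K] [IsAlgClosed K]
    [CharZero K] [Fintype ι] (p : MvPolynomial ι K) (a : ι → K) (r : K) :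
    ((fun x => aeval x p) '' {x : ι → K | ∑ i, (x i - a i) ^ 2 = r ∧
      ∃ c : K, ∀ i, aeval x (pderiv i p) = c * (x i - a i)}).Finite := by
  -- The index `none` carries the multiplier `c`.
  let X' : Option ι → MvPolynomial (Option ι) K := X
  let E : ι → MvPolynomial (Option ι) K := fun i =>
    aeval (X' ∘ some) (pderiv i p) - X' none * (X' (some i) - C (a i))
  let Q : MvPolynomial (Option ι) K := ∑ i, (X' (some i) - C (a i)) ^ 2 - C r
  let I : Ideal (MvPolynomial (Option ι) K) := Ideal.span (insert Q (Set.range E))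
  let R := MvPolynomial (Option ι) K ⧸ I
  let π : MvPolynomial (Option ι) K →ₐ[K] R := Ideal.Quotient.mkₐ K I
  let y : ι → R := fun i => π (X' (some i))
  have hy (q : MvPolynomial ι K) : π (aeval (X' ∘ some) q) = aeval y q := by
    rw [← AlgHom.comp_apply, comp_aeval]
    rfl
  have hC (k : K) : π (C k) = algebraMap K R k := π.commutes k
  have hE (i : ι) : aeval y (pderiv i p) = π (X' none) * (y i - algebraMap K R (a i)) := by
    have : π (E i) = 0 := Ideal.Quotient.eq_zero_iff_mem.mpr
      (Ideal.subset_span (Set.mem_insert_of_mem _ ⟨i, rfl⟩))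
    simpa only [E, map_sub, map_mul, hy, hC, sub_eq_zero] using this
  have hQ : ∑ i, (y i - algebraMap K R (a i)) ^ 2 = algebraMap K R r := by
    have : π Q = 0 := Ideal.Quotient.eq_zero_iff_mem.mpr
      (Ideal.subset_span (Set.mem_insert _ _))
    simpa only [Q, map_sub, map_sum, map_pow, hC, sub_eq_zero] using this
  have hD : KaehlerDifferential.D K R (aeval y p) = 0 :=
    Derivation.map_aeval_eq_zero_of_sphere _ hQ hE
  refine (finite_range_eval_of_kaehlerDifferential_D_eq_zero hD).subset ?_
  rintro _ ⟨x, ⟨hx, c, hc⟩, rfl⟩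
  let ev : MvPolynomial (Option ι) K →ₐ[K] K := aeval fun o => o.elim c x
  have hev (q : MvPolynomial ι K) : ev (aeval (X' ∘ some) q) = aeval x q := by
    rw [← AlgHom.comp_apply, comp_aeval]
    congr 2
    ext i
    simp [ev, X']
  have hI : ∀ g ∈ I, ev g = 0 := by
    change I ≤ RingHom.ker ev
    refine Ideal.span_le.mpr ?_
    rintro _ (rfl | ⟨i, rfl⟩)
    · simp [Q, ev, X', hx]
    · simp only [E, SetLike.mem_coe, RingHom.mem_ker, map_sub, hev, hc]
      simp [ev, X']
  refine ⟨Ideal.Quotient.liftₐ I ev hI, ?_⟩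
  change Ideal.Quotient.liftₐ I ev hI (aeval y p) = aeval x p
  rw [← hy, ← hev]
  rfl

theorem finite_polyVal_image_sphereCritSet {ι : Type*} [Fintype ι] (p : MvPolynomial ι ℝ)
    (a : ι → FFbar) : (polyVal p '' sphereCritSet p a).Finite := by
  have hv : algebraMap FF FFbar varpi ≠ 0 := by
    rw [map_ne_zero_iff _ (algebraMap FF FFbar).injective]
    intro h
    exact HahnSeries.single_ne_zero one_ne_zero (congrArg Subtype.val h)
  have : CharZero FFbar := charZero_of_injective_algebraMap (algebraMap ℝ FFbar).injective
  refine (MvPolynomial.finite_image_criticalSet_sphere (MvPolynomial.map (algebraMap ℝ FFbar) p) a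
    (algebraMap FF FFbar varpi)⁻¹).subset ?_
  rintro _ ⟨x, ⟨hx, c, hc⟩, rfl⟩
  refine ⟨x, ⟨?_, c, fun i => ?_⟩, ?_⟩
  · exact eq_inv_of_mul_eq_one_right (sub_eq_zero.mp hx)
  · rw [MvPolynomial.pderiv_map, MvPolynomial.aeval_map_algebraMap]
    exact hc i
  · exact MvPolynomial.aeval_map_algebraMap _ _ _

/-- If `x_n ≠ a_n`, the multiplier is `(∂p/∂x_n) / (x_n - a_n)`. If `x_n = a_n`, then `∂p/∂x_n ≠ 0`
and the `Φ_i` force `x = a`, which is not on the sphere. -/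
theorem mem_sphereCritSet_of_mem_GammaSet {m : ℕ} {p : MvPolynomial (Fin (m + 1)) ℝ}
    {a x : Fin (m + 1) → FFbar} (hx : x ∈ GammaSet p a)
    (h : ¬(x (Fin.last m) = a (Fin.last m) ∧ partialVal p (Fin.last m) x = 0)) :
    x ∈ sphereCritSet p a := by
  obtain ⟨hΦ, hS⟩ := hx
  simp only [Phi, sub_eq_zero] at hΦ
  by_cases hl : x (Fin.last m) = a (Fin.last m)
  · have hp : partialVal p (Fin.last m) x ≠ 0 := fun h0 => h ⟨hl, h0⟩
    have hxa : ∀ i, x i - a i = 0 := by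
      refine Fin.lastCases (sub_eq_zero.mpr hl) fun i => ?_
      have := hΦ i
      rw [hl, sub_self, zero_mul] at this
      exact (mul_eq_zero.mp this).resolve_right hp
    simp [sphereSet, hxa] at hS
  · have hl' : x (Fin.last m) - a (Fin.last m) ≠ 0 := sub_ne_zero.mpr hl
    refine ⟨hS, partialVal p (Fin.last m) x / (x (Fin.last m) - a (Fin.last m)), ?_⟩
    refine Fin.lastCases (div_mul_cancel₀ _ hl').symm fun i => ?_
    rw [div_mul_eq_mul_div, eq_div_iff hl', mul_comm, ← hΦ i, mul_comm]

theorem proposition3p2 (m : ℕ) (p : MvPolynomial (Fin (m + 1)) ℝ) (a : Fin (m + 1) → FFbar) :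
    (polyVal p '' DeltaSet p a).Finite ∧
    (polyVal p '' sphereCritSet p a).Finite ∧
    (polyVal p '' (GammaSet p a \
      {x | x (Fin.last m) = a (Fin.last m) ∧ partialVal p (Fin.last m) x = 0})).Finite := by
  have hfin := finite_polyVal_image_sphereCritSet p a
  refine ⟨hfin.subset (Set.image_mono fun x hx => ?_), hfin,
    hfin.subset (Set.image_mono fun x hx => mem_sphereCritSet_of_mem_GammaSet hx.1 hx.2)⟩
  exact mem_sphereCritSet_of_mem_GammaSet hx.1 fun h => hx.2 h.2
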